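/- Let $R=\mathbb Z_2^{\omega}$ be the ring of all sequences of elements of $\mathbb Z/2\mathbb Z$ with coordinatewise operations. For a subset $X$ of a ring $S$ write $S\cdot X=\{s x : s\in S,\ x\in X\}$, and for a subset $Y$ of an abelian group write $Y^{+n}=Y+\dots+Y$ ($n$ summands; $Y^{+0}=\{0\}$). (a) There are finite index subgroups $H_1\ge H_2\ge\cdots$ of $(R,+)$ such that for all $m\ge n\ge 1$ $$(R\cdot H_m)^{+n}\not\subseteq (R\cdot H_n)^{+(n-1)}.\qquad(\ast)$$ (b) Let $H_1\ge H_2\ge\cdots$ be any descending sequence of finite index subgroups of $(R,+)$ satisfying $(\ast)$ for all $m\ge n\ge1$. Equip $R$ with the full structure, i.e. regard $R$ as a first-order structure in which every subset of every finite Cartesian power $R^k$ is $\emptyset$-definable. Let $T$ be the complete theory of this structure, let $\kappa$ be a strong limit cardinal greater than $|T|$, and let $\bar R\succ R$ be a monster model, i.e. a $\kappa$-saturated and strongly $\kappa$-homogeneous elementary extension of $R$, considered with the interpretations in $\bar R$ of the ring operations. Let $\bar H_n\subseteq\bar R$ be the interpretation of $H_n$ in $\bar R$. Then $H:=\bigcap_{n\ge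 1}\bar H_n$ is a subgroup of $(\bar R,+)$ which is $\emptyset$-type-definable (an intersection of $\emptyset$-definable sets) and of bounded index (index less than $\kappa$), and $\bar R\cdot H$ does not generate a group in finitely many steps: for no $n$ is $(\bar R\cdot H)^{+n}$ equal to the subgroup of $(\bar R,+)$ generated by $\bar R\cdot H$. -/

import Mathlib

universe u v w

open FirstOrder

/-! ### First-order structures: full structure, type-definability, monster models -/

/-- The `L`-structure `M` is a *full structure*: all subsets of all finite Cartesian powers of `M`
are definable without parameters. -/
class FullStructure (L : FirstOrder.Language) (M : Type*) [L.Structure M] : Prop where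
  definable : ∀ (n : ℕ) (S : Set (Fin n → M)), (∅ : Set M).Definable L S

/-- A subset of `N` is type-definable over `∅`: it is an intersection of a family of subsets that
are definable without parameters. (There are at most `|T|` such sets, so that in a monster model
the family is automatically small.) -/
def IsTypeDefinable (L : FirstOrder.Language) {N : Type*} [L.Structure N] (X : Set N) : Prop :=
  ∃ F : Set (Set N), (∀ D ∈ F, (∅ : Set N).Definable₁ L D) ∧ X = ⋂₀ F

/-- `N` is `κ`-saturated: over every set `A ⊆ N` of fewer than `κ` parameters, every finitely
satisfiable set of formulas in finitely many variables is realized in `N`. -/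
def IsSaturated (L : FirstOrder.Language) (N : Type*) [L.Structure N] (κ : Cardinal) : Prop :=
  ∀ A : Set N, Cardinal.mk A < κ → ∀ (n : ℕ) (p : Set (L[[A]].Formula (Fin n))),
    (∀ q : Finset (L[[A]].Formula (Fin n)), (q : Set (L[[A]].Formula (Fin n))) ⊆ p →
      ∃ v : Fin n → N, ∀ φ ∈ q, φ.Realize v) →
    ∃ v : Fin n → N, ∀ φ ∈ p, φ.Realize v

/-- `N` is strongly `κ`-homogeneous: every partial elementary map of `N` into itself whose domain
has fewer than `κ` elements extends to an automorphism of `N`. -/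
def IsStronglyHomogeneous (L : FirstOrder.Language) (N : Type*) [L.Structure N] (κ : Cardinal) : Prop :=
  ∀ (A : Set N) (f : A → N), Cardinal.mk A < κ →
    (∀ (n : ℕ) (φ : L.Formula (Fin n)) (v : Fin n → A),
      φ.Realize (fun i => f (v i)) ↔ φ.Realize (fun i => (v i : N))) →
    ∃ σ : L.Equiv N N, ∀ a : A, σ (a : N) = f a

/-- `N` is a monster model, with degree of saturation `κ`, of its complete theory `T`: `κ` is a
strong limit cardinal greater than `|T| = max ℵ₀ |L|`, and `N` is `κ`-saturated and strongly
`κ`-homogeneous. -/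
structure IsMonster (L : FirstOrder.Language.{u, v}) (N : Type w) [L.Structure N]
    (κ : Cardinal.{w}) : Prop where
  strongLimit : κ.IsStrongLimit
  card_lt : Cardinal.lift.{w} (max Cardinal.aleph0 L.card) < Cardinal.lift.{max u v} κ
  saturated : IsSaturated L N κ
  homogeneous : IsStronglyHomogeneous L N κ

/-! ### Interpretation of definable sets in an elementary extension -/

/-- The underlying set of the elementary extension `ι : M ↪ₑ[L] N`; it carries the
interpretations in `N` of everything that is `∅`-definable in `M`. -/
def Bar {L : FirstOrder.Language} {M N : Type*} [L.Structure M] [L.Structure N] (_ι : M ↪ₑ[L] N) : Type _ :=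
  N

namespace Bar

section General

variable {L : FirstOrder.Language} {M N : Type*} [L.Structure M] [L.Structure N] (ι : M ↪ₑ[L] N)

instance instStructure : L.Structure (Bar ι) := inferInstanceAs (L.Structure N)

/-- The interpretation in the extension of a definable subset `S` of `M ^ n`: the set of solutions
in the extension of a formula that defines `S` in `M` (all such formulas are equivalent). -/
def interp {n : ℕ} (S : Set (Fin n → M)) : Set (Fin n → Bar ι) :=
  {x | ∃ φ : L.Formula (Fin n), (∀ v : Fin n → M, φ.Realize v ↔ v ∈ S) ∧ φ.Realize x}

/-- The interpretation in the extension of a definable subset `S` of `M`. -/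
def interp₁ (S : Set M) : Set (Bar ι) :=
  {x | (fun _ : Fin 1 => x) ∈ interp ι {v : Fin 1 → M | v 0 ∈ S}}

/-- A formula that holds everywhere in `M` holds everywhere in the extension. -/
theorem transfer {n : ℕ} (φ : L.Formula (Fin n)) (h : ∀ v : Fin n → M, φ.Realize v)
    (x : Fin n → Bar ι) : φ.Realize x := by
  have h1 := ι.map_formula ((φ.relabel (Sum.inr : Fin n → Empty ⊕ Fin n)).iAlls (Fin n))
    Empty.elim
  rw [Language.Formula.realize_iAlls, Language.Formula.realize_iAlls] at h1
  have h2 := h1.2 (fun i => by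
    rw [Language.Formula.realize_relabel]
    exact h _) x
  rw [Language.Formula.realize_relabel] at h2
  exact h2

theorem interp_eq {n : ℕ} {S : Set (Fin n → M)} (φ : L.Formula (Fin n))
    (h : ∀ v : Fin n → M, φ.Realize v ↔ v ∈ S) (x : Fin n → Bar ι) :
    x ∈ interp ι S ↔ φ.Realize x := by
  refine ⟨?_, fun hx => ⟨φ, h, hx⟩⟩
  rintro ⟨ψ, hψ, hx⟩
  have := transfer ι (ψ.imp φ) (fun v => by
    rw [Language.Formula.realize_imp, h, hψ]
    exact id) x
  rw [Language.Formula.realize_imp] at this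
  exact this hx

theorem mem_interp_inter {n : ℕ} {S T : Set (Fin n → M)} {x : Fin n → Bar ι}
    (hS : x ∈ interp ι S) (hT : x ∈ interp ι T) : x ∈ interp ι (S ∩ T) := by
  obtain ⟨φ, hφ, hx⟩ := hS
  obtain ⟨ψ, hψ, hy⟩ := hT
  refine ⟨φ ⊓ ψ, fun v => ?_, ?_⟩
  · rw [Language.Formula.realize_inf, hφ, hψ]
    rfl
  · rw [Language.Formula.realize_inf]
    exact ⟨hx, hy⟩

variable [FullStructure L M]

variable (L) in
/-- In a full structure, every subset of `M ^ n` is defined by a formula. -/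
theorem exists_formula {n : ℕ} (S : Set (Fin n → M)) :
    ∃ φ : L.Formula (Fin n), ∀ v : Fin n → M, φ.Realize v ↔ v ∈ S := by
  obtain ⟨φ, hφ⟩ := Set.empty_definable_iff.1 (FullStructure.definable (L := L) n S)
  exact ⟨φ, fun v => by rw [hφ]; rfl⟩

theorem existsUnique_op (f : M → M → M) (a b : Bar ι) :
    ∃! c : Bar ι, ![a, b, c] ∈ interp ι {v : Fin 3 → M | f (v 0) (v 1) = v 2} := by
  obtain ⟨φ, hφ⟩ := exists_formula L {v : Fin 3 → M | f (v 0) (v 1) = v 2}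
  have key : ∀ x, x ∈ interp ι {v : Fin 3 → M | f (v 0) (v 1) = v 2} ↔ φ.Realize x :=
    interp_eq ι φ hφ
  have hex := transfer ι ((φ.relabel ![Sum.inl 0, Sum.inl 1, Sum.inr (0 : Fin 1)]).iExs (Fin 1)
    : L.Formula (Fin 2)) (fun v => by
      rw [Language.Formula.realize_iExs]
      refine ⟨fun _ => f (v 0) (v 1), ?_⟩
      rw [Language.Formula.realize_relabel, hφ]
      simp) ![a, b]
  rw [Language.Formula.realize_iExs] at hex
  obtain ⟨c, hc⟩ := hex
  rw [Language.Formula.realize_relabel] at hc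
  refine ⟨c 0, ?_, ?_⟩
  · refine (key _).2 ?_
    convert hc using 1
    ext i
    fin_cases i <;> rfl
  · intro d hd
    have hu := transfer ι (((φ.relabel ![0, 1, 2]).imp ((φ.relabel ![0, 1, 3]).imp
      ((Language.Term.var 2).equal (Language.Term.var 3)))) : L.Formula (Fin 4)) (fun v => by
        simp only [Language.Formula.realize_imp, Language.Formula.realize_relabel, hφ,
          Language.Formula.realize_equal]
        intro h1 h2
        simp at h1 h2
        simp [← h1, ← h2]) ![a, b, d, c 0]
    simp only [Language.Formula.realize_imp, Language.Formula.realize_relabel,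
      Language.Formula.realize_equal] at hu
    refine hu ?_ ?_
    · convert (key _).1 hd using 1
      ext i
      fin_cases i <;> rfl
    · convert hc using 1
      ext i
      fin_cases i <;> rfl

/-- The binary operation on the extension whose graph is the interpretation of the graph of the
binary operation `f` on `M`. -/
noncomputable def op (f : M → M → M) (a b : Bar ι) : Bar ι :=
  (existsUnique_op ι f a b).choose

theorem mem_interp_iff_op (f : M → M → M) (a b c : Bar ι) :
    ![a, b, c] ∈ interp ι {v : Fin 3 → M | f (v 0) (v 1) = v 2} ↔ op ι f a b = c :=
  ⟨fun h => ((existsUnique_op ι f a b).choose_spec.2 c h).symm,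
    fun h => h ▸ (existsUnique_op ι f a b).choose_spec.1⟩

theorem interp_mono {n : ℕ} {S T : Set (Fin n → M)} (h : S ⊆ T) : interp ι S ⊆ interp ι T := by
  intro x hx
  obtain ⟨φ, hφ⟩ := exists_formula L S
  obtain ⟨ψ, hψ⟩ := exists_formula L T
  rw [interp_eq ι φ hφ] at hx
  rw [interp_eq ι ψ hψ]
  have := transfer ι (φ.imp ψ) (fun v => by
    rw [Language.Formula.realize_imp, hφ, hψ]
    exact fun hv => h hv) x
  rw [Language.Formula.realize_imp] at this
  exact this hx

theorem mem_interp_comp {m n : ℕ} (σ : Fin n → Fin m) (S : Set (Fin n → M)) (x : Fin m → Bar ι) :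
    x ∈ interp ι {v | v ∘ σ ∈ S} ↔ x ∘ σ ∈ interp ι S := by
  obtain ⟨φ, hφ⟩ := exists_formula L S
  rw [interp_eq ι φ hφ, interp_eq ι (φ.relabel σ) (fun v => by
    rw [Language.Formula.realize_relabel, hφ]
    rfl), Language.Formula.realize_relabel]

theorem mem_op {n : ℕ} (f : M → M → M) (x : Fin n → Bar ι) (i j k : Fin n) :
    x ∈ interp ι {v | f (v i) (v j) = v k} ↔ op ι f (x i) (x j) = x k := by
  have h := mem_interp_comp ι ![i, j, k] {v : Fin 3 → M | f (v 0) (v 1) = v 2} x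
  have e : x ∘ ![i, j, k] = ![x i, x j, x k] := by
    ext l
    fin_cases l <;> rfl
  rw [e, mem_interp_iff_op] at h
  exact h

theorem mem_const {n : ℕ} (m : M) (x : Fin n → Bar ι) (i : Fin n) (h : x i = ι m) :
    x ∈ interp ι {v | v i = m} := by
  have h1 := mem_interp_comp ι (fun _ : Fin 1 => i) {v : Fin 1 → M | v 0 = m} x
  refine h1.2 ?_
  obtain ⟨φ, hφ⟩ := exists_formula L {v : Fin 1 → M | v 0 = m}
  rw [interp_eq ι φ hφ]
  have h2 := (ι.map_formula φ (fun _ => m)).2 ((hφ _).2 rfl)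
  have e : x ∘ (fun _ : Fin 1 => i) = ι ∘ fun _ => m := funext fun _ => h
  rw [e]
  exact h2

end General

section Ring

variable {L : FirstOrder.Language} {M N : Type*} [CommRing M] [L.Structure M] [L.Structure N]
  (ι : M ↪ₑ[L] N) [FullStructure L M]

noncomputable instance instAdd : Add (Bar ι) := ⟨op ι (fun a b => a + b)⟩

noncomputable instance instMul : Mul (Bar ι) := ⟨op ι (fun a b => a * b)⟩

noncomputable instance instSub : Sub (Bar ι) := ⟨op ι (fun a b => a - b)⟩

instance instZero : Zero (Bar ι) := ⟨ι 0⟩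

instance instOne : One (Bar ι) := ⟨ι 1⟩

noncomputable instance instNeg : Neg (Bar ι) := ⟨fun a => 0 - a⟩

theorem mem_add {n : ℕ} (x : Fin n → Bar ι) (i j k : Fin n) :
    x ∈ interp ι {v | v i + v j = v k} ↔ x i + x j = x k :=
  mem_op ι (fun a b => a + b) x i j k

theorem mem_mul {n : ℕ} (x : Fin n → Bar ι) (i j k : Fin n) :
    x ∈ interp ι {v | v i * v j = v k} ↔ x i * x j = x k :=
  mem_op ι (fun a b => a * b) x i j k

theorem mem_sub {n : ℕ} (x : Fin n → Bar ι) (i j k : Fin n) :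
    x ∈ interp ι {v | v i - v j = v k} ↔ x i - x j = x k :=
  mem_op ι (fun a b => a - b) x i j k

theorem mem_zero {n : ℕ} (x : Fin n → Bar ι) (i : Fin n) (h : x i = 0) :
    x ∈ interp ι {v | v i = 0} :=
  mem_const ι 0 x i h

theorem mem_one {n : ℕ} (x : Fin n → Bar ι) (i : Fin n) (h : x i = 1) :
    x ∈ interp ι {v | v i = 1} :=
  mem_const ι 1 x i h

/-- The ring structure on the extension of a ring `M`: addition, subtraction and multiplication
are given by the interpretations of the graphs of the corresponding operations of `M`, zero and
one are those of `M`. -/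
noncomputable instance instCommRing : CommRing (Bar ι) where
  nsmul := nsmulRec
  zsmul := zsmulRec
  add_assoc a b c := by
    have h := interp_mono ι (S := (({v : Fin 6 → M | v 0 + v 1 = v 3} ∩
        {v | v 1 + v 2 = v 4}) ∩
        {v | v 3 + v 2 = v 5}))
      (T := {v | v 0 + v 4 = v 5})
      (fun v ⟨⟨h0, h1⟩, h2⟩ => by
        simp only [Set.mem_ofPred_eq] at h0 h1 h2 ⊢
        rw [← h2, ← h1, ← h0, add_assoc])
      (mem_interp_inter ι
        (mem_interp_inter ι
        ((mem_add ι ![a, b, c, a + b, b + c, a + b + c] 0 1 3).2 rfl)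
        ((mem_add ι ![a, b, c, a + b, b + c, a + b + c] 1 2 4).2 rfl))
        ((mem_add ι ![a, b, c, a + b, b + c, a + b + c] 3 2 5).2 rfl))
    exact ((mem_add ι ![a, b, c, a + b, b + c, a + b + c] 0 4 5).1 h).symm
  add_comm a b := by
    have h := interp_mono ι (S := {v : Fin 3 → M | v 0 + v 1 = v 2})
      (T := {v | v 1 + v 0 = v 2})
      (fun v h0 => by
        simp only [Set.mem_ofPred_eq] at h0 ⊢
        rw [← h0, add_comm])
      ((mem_add ι ![a, b, a + b] 0 1 2).2 rfl)
    exact ((mem_add ι ![a, b, a + b] 1 0 2).1 h).symm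
  zero_add a := by
    have h := interp_mono ι (S := {v : Fin 2 → M | v 0 = 0})
      (T := {v | v 0 + v 1 = v 1})
      (fun v h0 => by
        simp only [Set.mem_ofPred_eq] at h0 ⊢
        rw [h0, zero_add])
      (mem_zero ι ![0, a] 0 rfl)
    exact (mem_add ι ![0, a] 0 1 1).1 h
  add_zero a := by
    have h := interp_mono ι (S := {v : Fin 2 → M | v 0 = 0})
      (T := {v | v 1 + v 0 = v 1})
      (fun v h0 => by
        simp only [Set.mem_ofPred_eq] at h0 ⊢
        rw [h0, add_zero])
      (mem_zero ι ![0, a] 0 rfl)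
    exact (mem_add ι ![0, a] 1 0 1).1 h
  mul_assoc a b c := by
    have h := interp_mono ι (S := (({v : Fin 6 → M | v 0 * v 1 = v 3} ∩
        {v | v 1 * v 2 = v 4}) ∩
        {v | v 3 * v 2 = v 5}))
      (T := {v | v 0 * v 4 = v 5})
      (fun v ⟨⟨h0, h1⟩, h2⟩ => by
        simp only [Set.mem_ofPred_eq] at h0 h1 h2 ⊢
        rw [← h2, ← h1, ← h0, mul_assoc])
      (mem_interp_inter ι
        (mem_interp_inter ι
        ((mem_mul ι ![a, b, c, a * b, b * c, a * b * c] 0 1 3).2 rfl)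
        ((mem_mul ι ![a, b, c, a * b, b * c, a * b * c] 1 2 4).2 rfl))
        ((mem_mul ι ![a, b, c, a * b, b * c, a * b * c] 3 2 5).2 rfl))
    exact ((mem_mul ι ![a, b, c, a * b, b * c, a * b * c] 0 4 5).1 h).symm
  mul_comm a b := by
    have h := interp_mono ι (S := {v : Fin 3 → M | v 0 * v 1 = v 2})
      (T := {v | v 1 * v 0 = v 2})
      (fun v h0 => by
        simp only [Set.mem_ofPred_eq] at h0 ⊢
        rw [← h0, mul_comm])
      ((mem_mul ι ![a, b, a * b] 0 1 2).2 rfl)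
    exact ((mem_mul ι ![a, b, a * b] 1 0 2).1 h).symm
  one_mul a := by
    have h := interp_mono ι (S := {v : Fin 2 → M | v 0 = 1})
      (T := {v | v 0 * v 1 = v 1})
      (fun v h0 => by
        simp only [Set.mem_ofPred_eq] at h0 ⊢
        rw [h0, one_mul])
      (mem_one ι ![1, a] 0 rfl)
    exact (mem_mul ι ![1, a] 0 1 1).1 h
  mul_one a := by
    have h := interp_mono ι (S := {v : Fin 2 → M | v 0 = 1})
      (T := {v | v 1 * v 0 = v 1})
      (fun v h0 => by
        simp only [Set.mem_ofPred_eq] at h0 ⊢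
        rw [h0, mul_one])
      (mem_one ι ![1, a] 0 rfl)
    exact (mem_mul ι ![1, a] 1 0 1).1 h
  zero_mul a := by
    have h := interp_mono ι (S := {v : Fin 2 → M | v 0 = 0})
      (T := {v | v 0 * v 1 = v 0})
      (fun v h0 => by
        simp only [Set.mem_ofPred_eq] at h0 ⊢
        rw [h0, zero_mul])
      (mem_zero ι ![0, a] 0 rfl)
    exact (mem_mul ι ![0, a] 0 1 0).1 h
  mul_zero a := by
    have h := interp_mono ι (S := {v : Fin 2 → M | v 0 = 0})
      (T := {v | v 1 * v 0 = v 0})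
      (fun v h0 => by
        simp only [Set.mem_ofPred_eq] at h0 ⊢
        rw [h0, mul_zero])
      (mem_zero ι ![0, a] 0 rfl)
    exact (mem_mul ι ![0, a] 1 0 0).1 h
  neg_add_cancel a := by
    have h := interp_mono ι (S := ({v : Fin 3 → M | v 0 = 0} ∩
        {v | v 0 - v 1 = v 2}))
      (T := {v | v 2 + v 1 = v 0})
      (fun v ⟨h0, h1⟩ => by
        simp only [Set.mem_ofPred_eq] at h0 h1 ⊢
        rw [← h1, h0, sub_add_cancel])
      (mem_interp_inter ι
        (mem_zero ι ![0, a, -a] 0 rfl)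
        ((mem_sub ι ![0, a, -a] 0 1 2).2 rfl))
    exact (mem_add ι ![0, a, -a] 2 1 0).1 h
  sub_eq_add_neg a b := by
    have h := interp_mono ι (S := (({v : Fin 5 → M | v 0 = 0} ∩
        {v | v 0 - v 2 = v 3}) ∩
        {v | v 1 - v 2 = v 4}))
      (T := {v | v 1 + v 3 = v 4})
      (fun v ⟨⟨h0, h1⟩, h2⟩ => by
        simp only [Set.mem_ofPred_eq] at h0 h1 h2 ⊢
        rw [← h2, ← h1, h0, zero_sub, sub_eq_add_neg])
      (mem_interp_inter ι
        (mem_interp_inter ι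
        (mem_zero ι ![0, a, b, -b, a - b] 0 rfl)
        ((mem_sub ι ![0, a, b, -b, a - b] 0 2 3).2 rfl))
        ((mem_sub ι ![0, a, b, -b, a - b] 1 2 4).2 rfl))
    exact ((mem_add ι ![0, a, b, -b, a - b] 1 3 4).1 h).symm
  left_distrib a b c := by
    have h := interp_mono ι (S := ((({v : Fin 7 → M | v 1 + v 2 = v 3} ∩
        {v | v 0 * v 1 = v 4}) ∩
        {v | v 0 * v 2 = v 5}) ∩
        {v | v 4 + v 5 = v 6}))
      (T := {v | v 0 * v 3 = v 6})
      (fun v ⟨⟨⟨h0, h1⟩, h2⟩, h3⟩ => by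
        simp only [Set.mem_ofPred_eq] at h0 h1 h2 h3 ⊢
        rw [← h3, ← h2, ← h1, ← h0, mul_add])
      (mem_interp_inter ι
        (mem_interp_inter ι
        (mem_interp_inter ι
        ((mem_add ι ![a, b, c, b + c, a * b, a * c, a * b + a * c] 1 2 3).2 rfl)
        ((mem_mul ι ![a, b, c, b + c, a * b, a * c, a * b + a * c] 0 1 4).2 rfl))
        ((mem_mul ι ![a, b, c, b + c, a * b, a * c, a * b + a * c] 0 2 5).2 rfl))
        ((mem_add ι ![a, b, c, b + c, a * b, a * c, a * b + a * c] 4 5 6).2 rfl))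
    exact (mem_mul ι ![a, b, c, b + c, a * b, a * c, a * b + a * c] 0 3 6).1 h
  right_distrib a b c := by
    have h := interp_mono ι (S := ((({v : Fin 7 → M | v 0 + v 1 = v 3} ∩
        {v | v 0 * v 2 = v 4}) ∩
        {v | v 1 * v 2 = v 5}) ∩
        {v | v 4 + v 5 = v 6}))
      (T := {v | v 3 * v 2 = v 6})
      (fun v ⟨⟨⟨h0, h1⟩, h2⟩, h3⟩ => by
        simp only [Set.mem_ofPred_eq] at h0 h1 h2 h3 ⊢
        rw [← h3, ← h2, ← h1, ← h0, add_mul])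
      (mem_interp_inter ι
        (mem_interp_inter ι
        (mem_interp_inter ι
        ((mem_add ι ![a, b, c, a + b, a * c, b * c, a * c + b * c] 0 1 3).2 rfl)
        ((mem_mul ι ![a, b, c, a + b, a * c, b * c, a * c + b * c] 0 2 4).2 rfl))
        ((mem_mul ι ![a, b, c, a + b, a * c, b * c, a * c + b * c] 1 2 5).2 rfl))
        ((mem_add ι ![a, b, c, a + b, a * c, b * c, a * c + b * c] 4 5 6).2 rfl))
    exact (mem_mul ι ![a, b, c, a + b, a * c, b * c, a * c + b * c] 3 2 6).1 h

end Ring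

end Bar

/-! ### Products and sums of subsets of a ring -/

/-- The set `R · X` of all products `r * x` with `r` in the ring `R` and `x ∈ X`. -/
def ringMul {R : Type*} [Ring R] (X : Set R) : Set R :=
  {y | ∃ r : R, ∃ x ∈ X, y = r * x}

/-- The `n`-fold sum `X + ⋯ + X` of a subset of an additive group (equal to `{0}` for `n = 0`). -/
def foldSum {G : Type*} [AddCommGroup G] (X : Set G) (n : ℕ) : Set G :=
  {y | ∃ x : Fin n → G, (∀ i, x i ∈ X) ∧ y = ∑ i, x i}

/-- `X` generates a group in `n` steps: the subgroup generated by `X` is the `n`-fold sum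
`X + ⋯ + X`. -/
def GeneratesGroupIn {G : Type*} [AddCommGroup G] (X : Set G) (n : ℕ) : Prop :=
  (AddSubgroup.closure X : Set G) = foldSum X n

/-- A descending sequence `H₁ ≥ H₂ ≥ ⋯` of finite index subgroups of `(R, +)` such that, for all
`m ≥ n ≥ 1`, the `n`-fold sum of `R · H_m` is not contained in the `(n - 1)`-fold sum of
`R · H_n`. -/
structure IsStepSequence {R : Type*} [Ring R] (H : ℕ+ → AddSubgroup R) : Prop where
  antitone : Antitone H
  finiteIndex : ∀ n, (H n).FiniteIndex
  not_subset : ∀ m n : ℕ+, n ≤ m →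
    ¬ foldSum (ringMul (H m : Set R)) (n : ℕ) ⊆ foldSum (ringMul (H n : Set R)) ((n : ℕ) - 1)

/-! For (a), place disjoint copies of all the spaces `𝔽₂ ^ i` inside `ℕ` and let `H m` consist of
the sequences that are linear on the blocks `i ≤ m`. A sum of `n - 1` multiples of elements of `H n`
involves only `n - 1` linear forms on the block `𝔽₂ ^ n`, so it vanishes at a nonzero point of that
block. On the other hand, the `n` coordinate functions of the block, extended by zero, lie in every
`H m`, and suitable multiples of them add up to the indicator of the nonzero points. This is
`isStepSequence_blockLinear`.

For (b), bounded index holds because a coset of the intersection is determined by countably many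
choices among finitely many cosets (`mk_quotient_iInf_le`). For non-generation, condition (∗) makes
the following type finitely satisfiable: `n + 1` multipliers and `n + 1` elements of all the `H m`,
with sum of products outside the `n`-fold sum of `R · H (n + 1)`. Saturation gives a realization in
the extension, and its sum of products lies in the group generated by `R · H`. Were it also an
`n`-fold sum there, transferring that equation to the base ring would contradict the type; see
`not_generatesGroupIn_ringMul_iInf`. -/

namespace Bar

/-! ### Boolean operations and evaluation of functions in the extension -/

section General

variable {L : FirstOrder.Language} {M N : Type*} [L.Structure M] [L.Structure N] (ι : M ↪ₑ[L] N)

theorem not_mem_interp_empty {n : ℕ} (x : Fin n → Bar ι) : x ∉ interp ι (∅ : Set (Fin n → M)) := by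
  rw [interp_eq ι (⊥ : L.Formula (Fin n)) (fun v => by simp [Language.Formula.Realize]) x]
  simp [Language.Formula.Realize]

theorem mem_interp_univ {n : ℕ} (x : Fin n → Bar ι) : x ∈ interp ι (Set.univ : Set (Fin n → M)) :=
  ⟨⊤, fun v => by simp [Language.Formula.Realize], by simp [Language.Formula.Realize]⟩

theorem mem_interp_iInter {n : ℕ} {α : Type*} [Finite α] {S : α → Set (Fin n → M)}
    {x : Fin n → Bar ι} (h : ∀ a, x ∈ interp ι (S a)) : x ∈ interp ι (⋂ a, S a) := by
  classical
  have := Fintype.ofFinite α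
  have key : ∀ s : Finset α, x ∈ interp ι (⋂ a ∈ s, S a) := by
    intro s
    induction s using Finset.induction_on with
    | empty => simpa using mem_interp_univ ι x
    | insert a s _ ih =>
      rw [Finset.set_biInter_insert]
      exact mem_interp_inter ι (h a) ih
  simpa using key Finset.univ

variable [FullStructure L M]

theorem mem_interp_compl {n : ℕ} {S : Set (Fin n → M)} {x : Fin n → Bar ι}
    (h : x ∉ interp ι S) : x ∈ interp ι Sᶜ := by
  obtain ⟨φ, hφ⟩ := exists_formula L S
  rw [interp_eq ι φ hφ] at h
  exact ⟨φ.not, fun v => by rw [Language.Formula.realize_not, hφ]; rfl,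
    by rwa [Language.Formula.realize_not]⟩

/-- A point missed by every member would lie in the interpretation of the finite intersection of the
complements, which is empty. -/
theorem exists_mem_interp_of_iUnion {n : ℕ} {α : Type*} [Finite α] {S : α → Set (Fin n → M)}
    (hS : ⋃ a, S a = Set.univ) (x : Fin n → Bar ι) : ∃ a, x ∈ interp ι (S a) := by
  by_contra! h
  have h1 := mem_interp_iInter ι fun a => mem_interp_compl ι (h a)
  rw [← Set.compl_iUnion, hS, Set.compl_univ] at h1
  exact not_mem_interp_empty ι x h1

theorem mem_interp_apply {n : ℕ} (D : Set M) (x : Fin n → Bar ι) (i : Fin n) :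
    x ∈ interp ι {v | v i ∈ D} ↔ x i ∈ interp₁ ι D :=
  mem_interp_comp ι (fun _ : Fin 1 => i) {v | v 0 ∈ D} x

theorem definable₁_interp₁ (D : Set M) : (∅ : Set (Bar ι)).Definable₁ L (interp₁ ι D) := by
  obtain ⟨φ, hφ⟩ := exists_formula L {v : Fin 1 → M | v 0 ∈ D}
  refine Set.empty_definable_iff.2 ⟨φ, ?_⟩
  ext x
  have h := interp_eq ι φ hφ x
  have e : (fun _ : Fin 1 => x 0) = x := by
    ext i
    rw [Subsingleton.elim i 0]
  change (fun _ : Fin 1 => x 0) ∈ interp ι _ ↔ _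
  rw [e]
  exact h

/-- `c` is the value at the tuple `x` of the function on the extension that is obtained by
interpreting the graph of `f`. -/
def Tracks {k : ℕ} (x : Fin k → Bar ι) (f : (Fin k → M) → M) (c : Bar ι) : Prop :=
  Fin.append x ![c] ∈ interp ι {w : Fin (k + 1) → M | f (w ∘ Fin.castAdd 1) = w (Fin.natAdd k 0)}

/-- Arguments and value may sit anywhere in a longer tuple, so several evaluations can be compared
over one common tuple. -/
theorem tracks_comp_iff {k m : ℕ} (y : Fin m → Bar ι) (σ : Fin k → Fin m) (j : Fin m)
    (f : (Fin k → M) → M) :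
    Tracks ι (y ∘ σ) f (y j) ↔ y ∈ interp ι {w | f (w ∘ σ) = w j} := by
  have h := mem_interp_comp ι (Fin.append σ ![j])
    {w : Fin (k + 1) → M | f (w ∘ Fin.castAdd 1) = w (Fin.natAdd k 0)} y
  have e : y ∘ Fin.append σ ![j] = Fin.append (y ∘ σ) ![y j] := by
    ext i
    refine Fin.addCases (fun i => ?_) (fun i => ?_) i
    · simp
    · simp
  rw [e] at h
  rw [Tracks, ← h]
  have e2 : ∀ w : Fin m → M, (w ∘ Fin.append σ ![j]) ∘ Fin.castAdd 1 = w ∘ σ := by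
    intro w
    ext i
    simp
  simp [e2]

theorem append_comp_castAdd {α : Type*} {m n : ℕ} (x : Fin m → α) (y : Fin n → α) :
    Fin.append x y ∘ Fin.castAdd n = x := by
  ext i
  simp

theorem tracks_apply {k : ℕ} (x : Fin k → Bar ι) (i : Fin k) : Tracks ι x (fun v => v i) (x i) := by
  refine (tracks_comp_iff ι x id i (fun v => v i)).2 ?_
  convert mem_interp_univ ι x
  ext w
  simp

theorem Tracks.op {k : ℕ} {x : Fin k → Bar ι} {f g : (Fin k → M) → M} {a b : Bar ι}
    (hf : Tracks ι x f a) (hg : Tracks ι x g b) (F : M → M → M) :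
    Tracks ι x (fun v => F (f v) (g v)) (op ι F a b) := by
  have h (j : Fin 3) (f : (Fin k → M) → M) :=
    tracks_comp_iff ι (Fin.append x ![a, b, Bar.op ι F a b]) (Fin.castAdd 3) (Fin.natAdd k j) f
  simp only [append_comp_castAdd, Fin.append_right] at h
  refine (h 2 _).2 (interp_mono ι ?_ (mem_interp_inter ι (mem_interp_inter ι ((h 0 f).1 hf)
    ((h 1 g).1 hg)) ((mem_op ι F _ (Fin.natAdd k 0) (Fin.natAdd k 1) (Fin.natAdd k 2)).2 ?_)))
  · rintro v ⟨⟨h0, h1⟩, h2⟩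
    simp only [Set.mem_ofPred_eq] at h0 h1 h2 ⊢
    rw [h0, h1, h2]
  · simp

/-- The way back from the extension: an equality of two computed values becomes membership in an
interpreted set, to which `interp_mono` applies. -/
theorem Tracks.mem_eq {k : ℕ} {x : Fin k → Bar ι} {f g : (Fin k → M) → M} {a : Bar ι}
    (hf : Tracks ι x f a) (hg : Tracks ι x g a) : x ∈ interp ι {v | f v = g v} := by
  have h := interp_mono ι (T := {w : Fin (k + 1) → M | w ∘ Fin.castAdd 1 ∈ {v | f v = g v}})
    (by
      rintro v ⟨h0, h1⟩
      simp only [Set.mem_ofPred_eq] at h0 h1 ⊢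
      rw [h0, h1]) (mem_interp_inter ι hf hg)
  rwa [mem_interp_comp, append_comp_castAdd] at h

end General

/-! ### Finite sums, interpreted subgroups and bounded index -/

section Ring

variable {L : FirstOrder.Language} {M N : Type*} [CommRing M] [L.Structure M] [L.Structure N]
  (ι : M ↪ₑ[L] N) [FullStructure L M]

theorem tracks_zero {k : ℕ} (x : Fin k → Bar ι) : Tracks ι x (fun _ => 0) 0 :=
  interp_mono ι (fun _ h => Eq.symm h)
    (mem_zero ι (Fin.append x ![0]) (Fin.natAdd k 0) (by simp))

theorem tracks_sum {k l : ℕ} {x : Fin k → Bar ι} {f : Fin l → (Fin k → M) → M} {a : Fin l → Bar ι}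
    (h : ∀ i, Tracks ι x (f i) (a i)) : Tracks ι x (fun v => ∑ i, f i v) (∑ i, a i) := by
  induction l with
  | zero => simpa using tracks_zero ι x
  | succ l ih =>
    simp only [Fin.sum_univ_succ]
    exact (h 0).op ι (ih fun i => h i.succ) (· + ·)

/-- The interpretation in the extension of a subgroup of the additive group. -/
noncomputable def interpAddSubgroup (H : AddSubgroup M) : AddSubgroup (Bar ι) :=
  AddSubgroup.ofSub (interp₁ ι (H : Set M)) ⟨0, by
    refine interp_mono ι (fun v hv => ?_) (mem_zero ι (fun _ => 0) 0 rfl)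
    simp only [Set.mem_ofPred_eq] at hv ⊢
    rw [hv]
    exact H.zero_mem⟩ (fun a ha b hb => by
      rw [← sub_eq_add_neg]
      refine (mem_interp_apply ι _ ![a, b, a - b] 2).1 (interp_mono ι ?_
        (mem_interp_inter ι (mem_interp_inter ι ((mem_interp_apply ι _ ![a, b, a - b] 0).2 ha)
          ((mem_interp_apply ι _ ![a, b, a - b] 1).2 hb)) ((mem_sub ι ![a, b, a - b] 0 1 2).2 rfl)))
      rintro v ⟨⟨h0, h1⟩, h2⟩
      simp only [Set.mem_ofPred_eq] at h0 h1 h2 ⊢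
      rw [← h2]
      exact H.sub_mem h0 h1)

@[simp] theorem coe_interpAddSubgroup (H : AddSubgroup M) :
    (interpAddSubgroup ι H : Set (Bar ι)) = interp₁ ι (H : Set M) := rfl

theorem exists_coset (H : AddSubgroup M) [H.FiniteIndex] (x : Bar ι) :
    ∃ q : M ⧸ H, x ∈ interp₁ ι (QuotientAddGroup.mk ⁻¹' {q}) := by
  refine exists_mem_interp_of_iUnion ι
    (S := fun q : M ⧸ H => {v : Fin 1 → M | v 0 ∈ QuotientAddGroup.mk ⁻¹' {q}}) ?_ _
  ext v
  simp

theorem sub_mem_of_coset {H : AddSubgroup M} {q : M ⧸ H} {a b : Bar ι}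
    (ha : a ∈ interp₁ ι (QuotientAddGroup.mk ⁻¹' {q}))
    (hb : b ∈ interp₁ ι (QuotientAddGroup.mk ⁻¹' {q})) : -a + b ∈ interpAddSubgroup ι H := by
  rw [neg_add_eq_sub]
  refine (mem_interp_apply ι _ ![a, b, b - a] 2).1 (interp_mono ι ?_
    (mem_interp_inter ι (mem_interp_inter ι ((mem_interp_apply ι _ ![a, b, b - a] 0).2 ha)
      ((mem_interp_apply ι _ ![a, b, b - a] 1).2 hb)) ((mem_sub ι ![a, b, b - a] 1 0 2).2 rfl)))
  rintro v ⟨⟨h0, h1⟩, h2⟩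
  simp only [Set.mem_ofPred_eq, Set.mem_preimage, Set.mem_singleton_iff] at h0 h1 h2 ⊢
  rw [← h2, ← neg_add_eq_sub]
  exact QuotientAddGroup.eq.1 (h0.trans h1.symm)

/-- Two points in the same coset at every level `n` differ by an element of the intersection.
Numbering the cosets at each level embeds the quotient into the sequences of natural numbers. -/
theorem mk_quotient_iInf_le (H : ℕ+ → AddSubgroup M) (hH : ∀ n, (H n).FiniteIndex) :
    Cardinal.mk (Bar ι ⧸ ⨅ n, interpAddSubgroup ι (H n)) ≤ 2 ^ Cardinal.aleph0 := by
  have hfin (n : ℕ+) : ∃ g : M ⧸ H n → ℕ, Function.Injective g :=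
    (Countable.exists_injective_nat _)
  choose g hg using hfin
  choose c hc using fun (n : ℕ+) (x : Bar ι) => exists_coset ι (H n) x
  have hinj : Function.Injective
      (fun (q : Bar ι ⧸ ⨅ n, interpAddSubgroup ι (H n)) (n : ℕ+) => g n (c n q.out)) := by
    intro p q hpq
    rw [← QuotientAddGroup.out_eq' p, ← QuotientAddGroup.out_eq' q]
    refine QuotientAddGroup.eq.2 (AddSubgroup.mem_iInf.2 fun n => ?_)
    have h := hg n (congrFun hpq n)
    exact sub_mem_of_coset ι (hc n _) (h ▸ hc n _)
  have h := Cardinal.lift_mk_le_lift_mk_of_injective hinj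
  simpa using h

end Ring

end Bar

/-! ### Saturation for parameter-free types -/

theorem IsSaturated.exists_realize {L : FirstOrder.Language} {N : Type*} [L.Structure N]
    {κ : Cardinal} (h : IsSaturated L N κ) (hκ : 0 < κ) {k : ℕ} {α : Type*}
    (φ : α → L.Formula (Fin k))
    (hφ : ∀ s : Finset α, ∃ v : Fin k → N, ∀ a ∈ s, (φ a).Realize v) :
    ∃ v : Fin k → N, ∀ a, (φ a).Realize v := by
  classical
  obtain ⟨v, hv⟩ := h ∅ (by simpa using hκ) k
    (Set.range fun a => (L.lhomWithConstants (∅ : Set N)).onFormula (φ a)) (by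
      intro q hq
      choose b hb using fun ψ : q => hq ψ.2
      obtain ⟨v, hv⟩ := hφ (Finset.univ.image b)
      refine ⟨v, fun ψ hψ => ?_⟩
      have hψb : (L.lhomWithConstants (∅ : Set N)).onFormula (φ (b ⟨ψ, hψ⟩)) = ψ := hb ⟨ψ, hψ⟩
      rw [← hψb]
      exact (Language.LHom.realize_onFormula _ _).2
        (hv _ (Finset.mem_image_of_mem b (Finset.mem_univ _))))
  exact ⟨v, fun a => (Language.LHom.realize_onFormula _ _).1 (hv _ ⟨a, rfl⟩)⟩

namespace Bar

/-- Any finitely many indices have an upper bound `b`; a point of `S b` lies in all the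
corresponding sets, and its image under `ι` satisfies their formulas. -/
theorem exists_mem_interp {L : FirstOrder.Language} {M N : Type*} [L.Structure M] [L.Structure N]
    (ι : M ↪ₑ[L] N) [FullStructure L M] {κ : Cardinal} (h : IsSaturated L N κ) (hκ : 0 < κ) {k : ℕ}
    {α : Type*} [SemilatticeSup α] [Nonempty α] (S : α → Set (Fin k → M)) (hS : Antitone S)
    (hne : ∀ a, (S a).Nonempty) : ∃ x : Fin k → Bar ι, ∀ a, x ∈ interp ι (S a) := by
  choose φ hφ using fun a => exists_formula L (S a)
  obtain ⟨v, hv⟩ := h.exists_realize hκ φ (fun s => by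
    obtain ⟨b, hb⟩ := s.exists_le
    obtain ⟨v, hv⟩ := hne b
    exact ⟨fun i => ι (v i), fun a ha =>
      (ι.map_formula (φ a) v).2 ((hφ a v).2 (hS (hb a ha) hv))⟩)
  exact ⟨v, fun a => ⟨φ a, hφ a, hv a⟩⟩

end Bar

/-! ### Failure of generation in finitely many steps -/

theorem foldSum_subset_closure {G : Type*} [AddCommGroup G] (X : Set G) (n : ℕ) :
    foldSum X n ⊆ AddSubgroup.closure X := by
  rintro _ ⟨x, hx, rfl⟩
  exact sum_mem fun i _ => AddSubgroup.subset_closure (hx i)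

theorem mem_foldSum_ringMul {R : Type*} [Ring R] {X : Set R} {n : ℕ} {y : R} :
    y ∈ foldSum (ringMul X) n ↔ ∃ r x : Fin n → R, (∀ i, x i ∈ X) ∧ y = ∑ i, r i * x i := by
  constructor
  · rintro ⟨z, hz, rfl⟩
    choose r x hx hz using hz
    exact ⟨r, x, hx, by simp [← hz]⟩
  · rintro ⟨r, x, hx, rfl⟩
    exact ⟨fun i => r i * x i, fun i => ⟨r i, x i, hx i, rfl⟩, rfl⟩

theorem not_generatesGroupIn_ringMul_iInf {L : FirstOrder.Language} {M N : Type*} [CommRing M]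
    [L.Structure M] [L.Structure N] (ι : M ↪ₑ[L] N) [FullStructure L M] {κ : Cardinal}
    (hN : IsSaturated L N κ) (hκ : 0 < κ) {H : ℕ+ → AddSubgroup M} (hH : IsStepSequence H) (n : ℕ) :
    ¬ GeneratesGroupIn
      (ringMul ((⨅ m, Bar.interpAddSubgroup ι (H m) : AddSubgroup (Bar ι)) : Set (Bar ι))) n := by
  intro hgen
  -- The first `n + 1` coordinates are multipliers and the last `n + 1` are the elements of the
  -- subgroups. The excluded set is fixed at level `n.succPNat`, that is `n + 1`; only the
  -- membership condition varies with `m`.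
  obtain ⟨y, hy⟩ := Bar.exists_mem_interp ι hN hκ (k := (n + 1) + (n + 1))
    (fun m : ℕ+ => {v | (∀ i : Fin (n + 1), v (Fin.natAdd (n + 1) i) ∈ H m) ∧
      ∑ i : Fin (n + 1), v (Fin.castAdd (n + 1) i) * v (Fin.natAdd (n + 1) i) ∉
        foldSum (ringMul (H n.succPNat : Set M)) n})
    (fun a b hab v hv => ⟨fun i => hH.antitone hab (hv.1 i), hv.2⟩)
    (fun m => by
      -- Condition (∗) needs the first index to be at least `n + 1`, hence the supremum.
      have h : ¬ foldSum (ringMul (H (m ⊔ n.succPNat) : Set M)) (n + 1) ⊆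
          foldSum (ringMul (H n.succPNat : Set M)) n :=
        hH.not_subset (m ⊔ n.succPNat) n.succPNat le_sup_right
      obtain ⟨z, hz, hz'⟩ := Set.not_subset.1 h
      obtain ⟨r, x, hx, rfl⟩ := mem_foldSum_ringMul.1 hz
      refine ⟨Fin.append r x, fun i => ?_, ?_⟩
      · rw [Fin.append_right]
        exact hH.antitone le_sup_left (hx i)
      · simp only [Fin.append_left, Fin.append_right]
        exact hz')
  have hmem : ∑ i : Fin (n + 1), y (Fin.castAdd (n + 1) i) * y (Fin.natAdd (n + 1) i) ∈
      foldSum (ringMul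
        ((⨅ m, Bar.interpAddSubgroup ι (H m) : AddSubgroup (Bar ι)) : Set (Bar ι))) n := by
    rw [← hgen]
    refine foldSum_subset_closure _ (n + 1) (mem_foldSum_ringMul.2 ⟨_, _, fun i => ?_, rfl⟩)
    refine AddSubgroup.mem_iInf.2 fun m => ?_
    exact (Bar.mem_interp_apply ι _ y _).1 (Bar.interp_mono ι (fun v hv => hv.1 i) (hy m))
  obtain ⟨s, z, hz, heq⟩ := mem_foldSum_ringMul.1 hmem
  -- One tuple holds both representations of the same element, so that their equality can be
  -- transferred.
  let w : Fin (((n + 1) + (n + 1)) + (n + n)) → Bar ι := Fin.append y (Fin.append s z)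
  have hw1 (i) : w (Fin.castAdd _ i) = y i := by simp [w]
  have hw2 (i) : w (Fin.natAdd _ (Fin.castAdd _ i)) = s i := by simp [w]
  have hw3 (i) : w (Fin.natAdd _ (Fin.natAdd _ i)) = z i := by
    simp only [w]
    rw [Fin.append_right, Fin.append_right]
  have t1 := Bar.tracks_sum ι (x := w) fun i : Fin (n + 1) =>
    (Bar.tracks_apply ι w (Fin.castAdd _ (Fin.castAdd (n + 1) i))).op ι
      (Bar.tracks_apply ι w (Fin.castAdd _ (Fin.natAdd (n + 1) i))) (· * ·)
  have t2 := Bar.tracks_sum ι (x := w) fun i : Fin n =>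
    (Bar.tracks_apply ι w (Fin.natAdd _ (Fin.castAdd n i))).op ι
      (Bar.tracks_apply ι w (Fin.natAdd _ (Fin.natAdd n i))) (· * ·)
  simp only [hw1] at t1
  simp only [hw2, hw3] at t2
  have h1 := Bar.Tracks.mem_eq ι t1 ((show _ = _ from heq) ▸ t2)
  have h2 := Bar.mem_interp_iInter ι fun i : Fin n =>
    (Bar.mem_interp_apply ι (H n.succPNat : Set M) w (Fin.natAdd _ (Fin.natAdd n i))).2
      (hw3 i ▸ AddSubgroup.mem_iInf.1 (hz i) _)
  have h3 := (Bar.mem_interp_comp ι (Fin.castAdd (n + n)) _ w).2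
    ((Bar.append_comp_castAdd y (Fin.append s z)).symm ▸ hy n.succPNat)
  -- The equation, the memberships in `H (n + 1)` and the type are jointly unsatisfiable in the base
  -- ring, so their intersection has empty interpretation.
  refine Bar.not_mem_interp_empty ι w (Bar.interp_mono ι ?_
    (Bar.mem_interp_inter ι (Bar.mem_interp_inter ι h1 h2) h3))
  rintro v ⟨⟨g1, g2⟩, g3⟩
  simp only [Set.mem_iInter, Set.mem_ofPred_eq] at g1 g2 g3
  exact g3.2 (mem_foldSum_ringMul.2 ⟨_, _, g2, g1⟩)

/-! ### A step sequence of subgroups of `ℕ → ZMod 2` -/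

/-- The restriction of a sequence to the copy of `𝔽₂ ^ i` inside `ℕ`. -/
def restrictBlock (j : (Σ i : ℕ, Fin i → ZMod 2) → ℕ) (i : ℕ) :
    (ℕ → ZMod 2) →+ ((Fin i → ZMod 2) → ZMod 2) where
  toFun f v := f (j ⟨i, v⟩)
  map_zero' := rfl
  map_add' _ _ := rfl

/-- The sequences whose restriction to the copy of `𝔽₂ ^ i` inside `ℕ` is linear for all
`i ≤ m`. -/
def blockLinear (j : (Σ i : ℕ, Fin i → ZMod 2) → ℕ) (m : ℕ) : AddSubgroup (ℕ → ZMod 2) :=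
  ⨅ i : Fin (m + 1), AddSubgroup.comap (restrictBlock j i)
    (LinearMap.ltoFun (ZMod 2) (Fin i → ZMod 2) (ZMod 2) (ZMod 2)).range.toAddSubgroup

theorem mem_blockLinear {j : (Σ i : ℕ, Fin i → ZMod 2) → ℕ} {m : ℕ} {f : ℕ → ZMod 2} :
    f ∈ blockLinear j m ↔
      ∀ i ≤ m, ∃ l : (Fin i → ZMod 2) →ₗ[ZMod 2] ZMod 2, ∀ v, l v = f (j ⟨i, v⟩) := by
  simp only [blockLinear, AddSubgroup.mem_iInf, AddSubgroup.mem_comap, Submodule.mem_toAddSubgroup,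
    LinearMap.mem_range]
  constructor
  · intro h i hi
    obtain ⟨l, hl⟩ := h ⟨i, Nat.lt_succ_of_le hi⟩
    exact ⟨l, fun v => congrFun hl v⟩
  · intro h i
    obtain ⟨l, hl⟩ := h i (Nat.le_of_lt_succ i.2)
    exact ⟨l, funext hl⟩

theorem isStepSequence_blockLinear {j : (Σ i : ℕ, Fin i → ZMod 2) → ℕ}
    (hj : Function.Injective j) : IsStepSequence fun m : ℕ+ => blockLinear j m where
  antitone a b hab f hf :=
    mem_blockLinear.2 fun i hi => mem_blockLinear.1 hf i (hi.trans (PNat.coe_le_coe _ _ |>.2 hab))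
  finiteIndex m := by
    refine AddSubgroup.finiteIndex_iInf fun i => ?_
    -- The kernel of restriction to a block already has finite index, since a finite block carries
    -- finitely many functions.
    exact AddSubgroup.finiteIndex_of_le (AddMonoidHom.ker_le_comap _ _)
  not_subset m n _ hsub := by
    classical
    -- The `t`-th coordinate function of block `n`. The default `0` off the block makes it linear on
    -- all other blocks, so it lies in `H m` for every `m`.
    let e : Fin n → ℕ → ZMod 2 := fun t a =>
      if h : ∃ v : Fin n → ZMod 2, j ⟨n, v⟩ = a then h.choose t else 0
    have he (t v) : e t (j ⟨n, v⟩) = v t := by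
      have h : ∃ v' : Fin n → ZMod 2, j ⟨n, v'⟩ = j ⟨n, v⟩ := ⟨v, rfl⟩
      have h2 : h.choose = v := by simpa using hj h.choose_spec
      simp only [e, dif_pos h, h2]
    have he' (t i v) (hi : i ≠ (n : ℕ)) : e t (j ⟨i, v⟩) = 0 := by
      refine dif_neg fun ⟨v', hv'⟩ => hi ?_
      exact congrArg Sigma.fst (hj hv').symm
    have heH (t) : e t ∈ blockLinear j m := by
      refine mem_blockLinear.2 fun i _ => ?_
      by_cases hi : i = (n : ℕ)
      · subst hi
        exact ⟨LinearMap.proj t, fun v => (he t v).symm⟩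
      · exact ⟨0, fun v => (he' t i v hi).symm⟩
    -- `r t` marks the points of the block whose first nonzero coordinate is the `t`-th.
    let r : Fin n → ℕ → ZMod 2 := fun t a => if ∀ s < t, e s a = 0 then 1 else 0
    obtain ⟨c, x, hx, hcx⟩ := mem_foldSum_ringMul.1
      (hsub (mem_foldSum_ringMul.2 ⟨r, e, heH, rfl⟩))
    choose l hl using fun s => mem_blockLinear.1 (hx s) n le_rfl
    -- Dimension count: `n - 1` linear forms on `𝔽₂ ^ n` have a common nonzero zero.
    obtain ⟨v, hv, hv0⟩ := (LinearMap.pi l).ker.exists_mem_ne_zero_of_ne_bot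
      (LinearMap.ker_ne_bot_of_finrank_lt (by simp [n.pos]))
    have hlv (s) : l s v = 0 := congrFun (LinearMap.mem_ker.1 hv) s
    have h0 := congrFun hcx (j ⟨n, v⟩)
    simp only [Finset.sum_apply, Pi.mul_apply, ← hl, hlv, mul_zero, Finset.sum_const_zero] at h0
    obtain ⟨t, ht, hmin⟩ : ∃ t, v t ≠ 0 ∧ ∀ s < t, v s = 0 := by
      obtain ⟨t, ht⟩ := Function.ne_iff.1 hv0
      obtain ⟨t, ht, hmin⟩ := WellFounded.has_min (wellFounded_lt (α := Fin n)) {t | v t ≠ 0} ⟨t, ht⟩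
      exact ⟨t, ht, fun s hs => by_contra fun h => hmin s h hs⟩
    -- With `t` the first nonzero coordinate of `v`, earlier terms vanish because `v s = 0` and
    -- later ones because the marker `r s` is zero. The left side is therefore `v t`, which is
    -- nonzero.
    rw [Finset.sum_eq_single t] at h0
    · simp only [r, he] at h0
      rw [if_pos hmin, one_mul] at h0
      exact ht h0
    · intro s _ hst
      simp only [r, he]
      rcases lt_or_gt_of_ne hst with h | h
      · rw [hmin s h, mul_zero]
      · rw [if_neg fun h' => ht (h' t h), zero_mul]
    · simp

theorem mainTheorem10 :
    (∃ H : ℕ+ → AddSubgroup (ℕ → ZMod 2), IsStepSequence H) ∧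
    ∀ H : ℕ+ → AddSubgroup (ℕ → ZMod 2), IsStepSequence H →
      ∀ (L : FirstOrder.Language.{u, v}) [L.Structure (ℕ → ZMod 2)]
        [FullStructure L (ℕ → ZMod 2)] (N : Type w) [L.Structure N] (κ : Cardinal.{w})
        (_ : IsMonster L N κ) (ι : (ℕ → ZMod 2) ↪ₑ[L] N),
        ∃ K : AddSubgroup (Bar ι),
          (K : Set (Bar ι)) = ⋂ n : ℕ+, Bar.interp₁ ι (H n : Set (ℕ → ZMod 2)) ∧
          IsTypeDefinable L (K : Set (Bar ι)) ∧
          Cardinal.mk (Bar ι ⧸ K) < κ ∧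
          ∀ n : ℕ, ¬ GeneratesGroupIn (ringMul (K : Set (Bar ι))) n := by
  constructor
  · obtain ⟨j, hj⟩ := Countable.exists_injective_nat (Σ i : ℕ, Fin i → ZMod 2)
    exact ⟨_, isStepSequence_blockLinear hj⟩
  · intro H hH L _ _ N _ κ hκ ι
    have hcoe : ((⨅ n, Bar.interpAddSubgroup ι (H n) : AddSubgroup (Bar ι)) : Set (Bar ι)) =
        ⋂ n : ℕ+, Bar.interp₁ ι (H n : Set (ℕ → ZMod 2)) := by
      simp
    have haleph : Cardinal.aleph0 < κ := by
      have h := (Cardinal.lift_le.2 (le_max_left Cardinal.aleph0 L.card)).trans_lt hκ.card_lt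
      simpa using h
    refine ⟨⨅ n, Bar.interpAddSubgroup ι (H n), hcoe, ?_, ?_, fun n => ?_⟩
    · refine ⟨Set.range fun n => Bar.interp₁ ι (H n : Set (ℕ → ZMod 2)), ?_, ?_⟩
      · rintro _ ⟨n, rfl⟩
        exact Bar.definable₁_interp₁ ι _
      · rw [hcoe, Set.sInter_range]
    · exact (Bar.mk_quotient_iInf_le ι H hH.finiteIndex).trans_lt
        (hκ.strongLimit.isStrongPrelimit haleph)
    · exact not_generatesGroupIn_ringMul_iInf ι hκ.saturated (Cardinal.aleph0_pos.trans haleph) hH n
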